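/- Let $\mathcal H$ be a real Hilbert space and $A,B:\mathcal H\rightrightarrows\mathcal H$ set-valued operators. For $\sigma\in\mathbb R$, $A$ is $\sigma$-comonotone if $\langle x-y,u-v\rangle\ge\sigma\|u-v\|^2$ for all $(x,u),(y,v)$ in its graph, and maximal $\sigma$-comonotone if moreover no $\sigma$-comonotone operator has a graph properly containing that of $A$. Write $\operatorname{zer}(A)=\{x:0\in A(x)\}$, $\operatorname{Fix}(A)=\{x:x\in A(x)\}$, $J_{\gamma A}=(\mathrm{Id}+\gamma A)^{-1}$, $J_{\gamma A}^{\lambda}=\lambda J_{\gamma A}+(1-\lambda)\mathrm{Id}$, and ${}^{\gamma}\!A=\frac1\gamma(\mathrm{Id}-J_{\gamma A})$ (the Yosida approximation). Suppose that $A$ is maximal $\alpha$-comonotone and $B$ is maximal $\beta$-comonotone, with $\alpha+\beta\ge 0$ and $\operatorname{zer}(A+B)\ne\emptyset$. Let $\gamma,\delta>0$ and $\lambda,\mu>1$ satisfy $$(\lambda-1)(\mu-1)=1,\qquad \delta=\gamma(\lambda-1),$$ and $$\delta=\gamma+2\alpha\ \text{ if }\alpha+\beta=0,\qquad (\gamma+\delta)^2<4(\gamma+\alpha)(\delta+\beta)\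 \text{ if }\alpha+\beta>0.$$ Let $0<\kappa<\kappa^*$, where $\kappa^*=1$ if $\alpha+\beta=0$ and $$\kappa^*=\frac{4(\gamma+\alpha)(\delta+\beta)-(\gamma+\delta)^2}{2(\gamma+\delta)(\alpha+\beta)}\quad\text{if }\alpha+\beta>0,$$ and let $T_{A,B}=(1-\kappa)\mathrm{Id}+\kappa J_{\delta B}^{\mu}J_{\gamma A}^{\lambda}$. Then $J_{\gamma A}$ and $J_{\delta B}$ are single-valued with full domain, and for every initial point $x^0\in\mathcal H$ the sequences generated by the adaptive Douglas--Rachford (aDR) algorithm $$y^k\in J_{\gamma A}(x^k),\qquad z^k\in J_{\delta B}((1-\lambda)x^k+\lambda y^k),\qquad x^{k+1}=x^k+\kappa\mu(z^k-y^k)\qquad(k\in\mathbb N)$$ have the following properties. (i) There is $\bar x\in\operatorname{Fix}(T_{A,B})$ with $J_{\gamma A}(\bar x)\in\operatorname{zer}(A+B)$ such that $x^k\rightharpoonup\bar x$ weakly. (ii) $\|x^k-x^{k+1}\|=o(1/\sqrt k)$ and $\|y^k-y^{k+1}\|=o(1/\sqrt k)$ as $k\to\infty$. (iii) The sequences $\{y^k\}$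 and $\{z^k\}$ converge weakly to $J_{\gamma A}(\bar x)$. (iv) If $\alpha+\beta>0$, $0<\kappa<1$, and either (a) $\gamma+2\alpha>0$ and $\kappa^*\ge1$, or (b) $\gamma=\delta$, $\lambda=\mu=2$ and $\kappa<\kappa^*$, then $\{x^k-y^k\}$ and $\{x^k-z^k\}$ converge strongly to $\gamma\,{}^{\gamma}\!A(\bar x)=\bar x-J_{\gamma A}(\bar x)$, and $\gamma\,{}^{\gamma}\!A(\bar x)+\operatorname{zer}(A+B)=\operatorname{Fix}(T_{A,B})$. -/

import Mathlib

open Filter Topology Asymptotics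
open scoped Pointwise InnerProductSpace

namespace ADR

noncomputable section

/-- Set-valued operators on `H`. Sums, differences and scalar multiples of such operators
are the pointwise (Minkowski) ones. -/
abbrev SetOp (H : Type*) : Type _ := H → Set H

section SetValued

variable {H : Type*}

/-- The graph of a set-valued operator. -/
def gra (A : SetOp H) : Set (H × H) := {p | p.2 ∈ A p.1}

/-- The inverse operator: `x ∈ A⁻¹ u` if and only if `u ∈ A x`. -/
def inv (A : SetOp H) : SetOp H := fun u => {x | u ∈ A x}

/-- The identity, as a (single-valued) set-valued operator. -/
def idOp : SetOp H := fun x => {x}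

/-- The composition `S ∘ R`, with `(S ∘ R) x` the direct image of the set `R x` under `S`. -/
def comp (S R : SetOp H) : SetOp H := fun x => ⋃ y ∈ R x, S y

/-- The zeros of a set-valued operator. -/
def zer [Zero H] (A : SetOp H) : Set H := {x | (0 : H) ∈ A x}

/-- The fixed points of a set-valued operator. -/
def fixedPts (A : SetOp H) : Set H := {x | x ∈ A x}

end SetValued

section Hilbert

variable {H : Type*} [NormedAddCommGroup H] [InnerProductSpace ℝ H]

/-- The resolvent `J_{γ A} = (Id + γ A)⁻¹`. -/
def resolvent (γ : ℝ) (A : SetOp H) : SetOp H := inv (idOp + γ • A)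

/-- The Yosida approximation `(1 / γ) (Id - J_{γ A})`. -/
def yosida (γ : ℝ) (A : SetOp H) : SetOp H := (1 / γ) • (idOp - resolvent γ A)

/-- The relaxed resolvent `lam J_{γ A} + (1 - lam) Id`. -/
def relaxedResolvent (lam γ : ℝ) (A : SetOp H) : SetOp H :=
  lam • resolvent γ A + (1 - lam) • (idOp : SetOp H)

/-- `A` is `σ`-comonotone. -/
def IsComonotone (σ : ℝ) (A : SetOp H) : Prop :=
  ∀ x u y v : H, (x, u) ∈ gra A → (y, v) ∈ gra A → σ * ‖u - v‖ ^ 2 ≤ ⟪x - y, u - v⟫_ℝ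

/-- `A` is maximal `σ`-comonotone: it is `σ`-comonotone and no `σ`-comonotone operator has a
graph that properly contains the graph of `A`. -/
def IsMaximalComonotone (σ : ℝ) (A : SetOp H) : Prop :=
  IsComonotone σ A ∧ ∀ B : SetOp H, IsComonotone σ B → gra A ⊆ gra B → gra B = gra A

/-- Pointwise form of maximality: the graph of `A` is the set of all pairs that are
`σ`-comonotonically related to it. -/
theorem isMaximalComonotone_iff (σ : ℝ) (A : SetOp H) :
    IsMaximalComonotone σ A ↔
      ∀ x u : H, (x, u) ∈ gra A ↔
        ∀ y v : H, (y, v) ∈ gra A → σ * ‖u - v‖ ^ 2 ≤ ⟪x - y, u - v⟫_ℝ := by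
  constructor
  · rintro ⟨hA, hmax⟩ x u
    refine ⟨fun h y v hy => hA x u y v h hy, fun h => ?_⟩
    have hB : IsComonotone σ (fun a => A a ∪ {w | a = x ∧ w = u}) := by
      rintro a w b t (ha | ⟨rfl, rfl⟩) (hb | ⟨rfl, rfl⟩)
      · exact hA a w b t ha hb
      · have h1 := h a w ha
        have e1 : a - b = -(b - a) := by abel
        have e2 : w - t = -(t - w) := by abel
        rw [e1, e2, inner_neg_neg, norm_neg]
        exact h1
      · exact h b t hb
      · simp
    rw [← hmax _ hB (fun p hp => Or.inl hp)]
    exact Or.inr ⟨rfl, rfl⟩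
  · intro h
    have hA : IsComonotone σ A := fun x u y v hx hy => (h x u).1 hx y v hy
    refine ⟨hA, fun B hB hsub => Set.Subset.antisymm ?_ hsub⟩
    rintro ⟨x, u⟩ hxu
    exact (h x u).2 fun y v hy => hB x u y v hxu (hsub hy)

/-- The adaptive Douglas-Rachford operator
`T_{A,B} = (1 - κ) Id + κ J_{δ B}^{mu} J_{γ A}^{lam}`. -/
def aDROperator (κ γ δ lam mu : ℝ) (A B : SetOp H) : SetOp H :=
  (1 - κ) • (idOp : SetOp H) +
    κ • comp (relaxedResolvent mu δ B) (relaxedResolvent lam γ A)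

/-- `(x^k, y^k, z^k)` is generated by the adaptive Douglas-Rachford algorithm, started at the
(arbitrary) point `x 0`. -/
structure IsADRSequence (κ γ δ lam mu : ℝ) (A B : SetOp H) (x y z : ℕ → H) : Prop where
  y_mem : ∀ k, y k ∈ resolvent γ A (x k)
  z_mem : ∀ k, z k ∈ resolvent δ B ((1 - lam) • x k + lam • y k)
  x_succ : ∀ k, x (k + 1) = x k + (κ * mu) • (z k - y k)

/-- The upper bound `κ*` for the relaxation parameter (used for `α + β ≥ 0` only). -/
def kappaStar (α β γ δ : ℝ) : ℝ :=
  if α + β = 0 then 1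
  else (4 * (γ + α) * (δ + β) - (γ + δ) ^ 2) / (2 * (γ + δ) * (α + β))

/-- Weak convergence of a sequence in `H`. -/
def WeaklyTendsto (x : ℕ → H) (a : H) : Prop :=
  Tendsto (fun k => toWeakSpace ℝ H (x k)) atTop (𝓝 (toWeakSpace ℝ H a))

end Hilbert

end

end ADR

/-!
The algorithm is best read on the graphs of `A` and `B`. If `a k ∈ A (y k)` and `b k ∈ B (z k)` are
the points selected by the two resolvents, so that `x k = y k + γ a k` and
`y k - δ a k = z k + δ b k`, then the assumptions on `γ`, `δ`, `lam` and `mu` turn one step into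
`x (k + 1) = x k - κ (γ + δ) (a k + b k)`, and the fixed points of the operator are the vectors
`p + γ c` with `c ∈ A p` and `-c ∈ B p`.

*Resolvents.* If `0 < γ + α`, then `Id + γ A` is onto for a maximal `α`-comonotone `A`: this is
Minty's theorem for the monotone relation between `y - α a` and `a`. It is proved as an intersection
property of balls; finitely many balls meet by a minimax argument on the simplex
(`exists_forall_inner_sub_sub_nonpos`), and weak compactness gives the general case.

*Descent.* For two instances of a step, the two comonotonicity inequalities bound the inner product
of the differences of `x` and of `a + b` from below by the quadratic form
`(γ + α) ‖a‖² + (δ + β) ‖b‖² + (γ + δ) ⟪a, b⟫`. The number `κ* (γ + δ) / 2` is the largest `c`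
for which this form dominates `c ‖a + b‖²`, so for `κ < κ*` there is a descent with a surplus
`η ‖a + b‖²`, and also a surplus `ε ‖a‖²` if `0 < α + β` (`exists_descent`). Comparison with a
solution makes `x` Fejér monotone and `‖a k + b k‖` square summable; comparison of consecutive
iterates makes the step lengths nonincreasing, whence the rate `o(1 / √k)`. The surplus `ε ‖a‖²`
gives strong convergence of `a k`.

*Weak limits.* The sum of the two comonotonicity inequalities passes to weak limits because the
products `⟪y k, a k⟫` cancel when `a k + b k → 0`; tested with the resolvents at the limit it shows
that weak cluster points of `(y k, a k)` are solutions (`mem_of_weakLim`). Opial's lemma then yields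
weak convergence. Weak limits are taken along ultrafilters, along which every bounded family in a
Hilbert space converges.
-/

namespace ADR

variable {H : Type*} [NormedAddCommGroup H] [InnerProductSpace ℝ H]

/-! ### Weak limits along filters -/

/-- Weak convergence of `x` to `a` along the filter `l`, in terms of inner products. -/
def WeakLim {ι : Type*} (l : Filter ι) (x : ι → H) (a : H) : Prop :=
  ∀ w : H, Tendsto (fun k => ⟪x k, w⟫_ℝ) l (𝓝 ⟪a, w⟫_ℝ)

namespace WeakLim

variable {ι : Type*} {l : Filter ι} {x y : ι → H} {a b : H}

theorem mono {l' : Filter ι} (h : WeakLim l x a) (hl : l' ≤ l) : WeakLim l' x a :=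
  fun w => (h w).mono_left hl

theorem of_tendsto (h : Tendsto x l (𝓝 a)) : WeakLim l x a :=
  fun _ => h.inner tendsto_const_nhds

theorem sub (hx : WeakLim l x a) (hy : WeakLim l y b) :
    WeakLim l (fun k => x k - y k) (a - b) := fun w => by
  simpa only [inner_sub_left] using (hx w).sub (hy w)

theorem smul (c : ℝ) (hx : WeakLim l x a) : WeakLim l (fun k => c • x k) (c • a) := fun w => by
  simpa only [real_inner_smul_left] using (hx w).const_mul c

theorem of_ultrafilter (h : ∀ U : Ultrafilter ι, (U : Filter ι) ≤ l → WeakLim U x a) :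
    WeakLim l x a :=
  fun w => (tendsto_iff_ultrafilter _ _ _).2 fun U hU => h U hU w

variable [CompleteSpace H]

theorem weaklyTendsto {x : ℕ → H} (h : WeakLim atTop x a) : WeaklyTendsto x a := by
  have hinj : Function.Injective (topDualPairing ℝ H).flip := fun u v huv =>
    ext_inner_left ℝ fun w => by
      simpa using LinearMap.congr_fun huv (InnerProductSpace.toDual ℝ H w)
  refine (WeakBilin.tendsto_iff_forall_eval_tendsto _ hinj).2 fun f => ?_
  have h1 := h ((InnerProductSpace.toDual ℝ H).symm f)
  simp only [real_inner_comm ((InnerProductSpace.toDual ℝ H).symm f),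
    InnerProductSpace.toDual_symm_apply] at h1
  exact h1

end WeakLim

/-- Bounded families in a Hilbert space converge weakly along every ultrafilter: the limits of
the inner products define a bounded functional, which the Riesz representation turns into a
vector. -/
theorem exists_weakLim_of_bounded [CompleteSpace H] {ι : Type*} (U : Ultrafilter ι) {x : ι → H}
    {C : ℝ} (hx : ∀ᶠ k in (U : Filter ι), ‖x k‖ ≤ C) : ∃ a, WeakLim (U : Filter ι) x a := by
  have key : ∀ w : H, ∃ r : ℝ, |r| ≤ C * ‖w‖ ∧
      Tendsto (fun k => ⟪x k, w⟫_ℝ) (U : Filter ι) (𝓝 r) := by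
    intro w
    have hK : IsCompact (Set.Icc (-(C * ‖w‖)) (C * ‖w‖)) := isCompact_Icc
    obtain ⟨r, hr, hle⟩ := hK.ultrafilter_le_nhds (U.map fun k => ⟪x k, w⟫_ℝ) (by
      rw [le_principal_iff]
      change ∀ᶠ k in (U : Filter ι), ⟪x k, w⟫_ℝ ∈ Set.Icc (-(C * ‖w‖)) (C * ‖w‖)
      filter_upwards [hx] with k hk
      exact abs_le.1 ((abs_real_inner_le_norm _ _).trans (by gcongr)))
    exact ⟨r, abs_le.2 hr, hle⟩
  choose f hfC hf using key
  let g : H →ₗ[ℝ] ℝ :=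
    { toFun := f
      map_add' := fun v w => tendsto_nhds_unique (hf (v + w)) (by
        simpa only [inner_add_right] using (hf v).add (hf w))
      map_smul' := fun c w => tendsto_nhds_unique (hf (c • w)) (by
        simpa only [real_inner_smul_right, smul_eq_mul, RingHom.id_apply] using
          (hf w).const_mul c) }
  refine ⟨(InnerProductSpace.toDual ℝ H).symm (g.mkContinuous C hfC), fun w => ?_⟩
  rw [InnerProductSpace.toDual_symm_apply]
  exact hf w

/-- A weak limit of points of a closed ball `{x | ⟪x - p, x - q⟫ ≤ 0}`, described by the end
points of a diameter, lies in that ball. -/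
theorem WeakLim.inner_sub_sub_nonpos {ι : Type*} {l : Filter ι} [l.NeBot] {x : ι → H} {a p q : H}
    (h : WeakLim l x a) (hx : ∀ᶠ k in l, ⟪x k - p, x k - q⟫_ℝ ≤ 0) :
    ⟪a - p, a - q⟫_ℝ ≤ 0 := by
  -- the ball inequality implies the affine one `⟪x, 2 a - p - q⟫ - ‖a‖ ^ 2 + ⟪p, q⟫ ≤ 0`
  have h1 : Tendsto (fun k => ⟪x k, (2 : ℝ) • a - p - q⟫_ℝ - ‖a‖ ^ 2 + ⟪p, q⟫_ℝ) l
      (𝓝 (⟪a, (2 : ℝ) • a - p - q⟫_ℝ - ‖a‖ ^ 2 + ⟪p, q⟫_ℝ)) :=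
    ((h _).sub_const _).add_const _
  have h2 := le_of_tendsto h1 (b := 0) (by
    filter_upwards [hx] with k hk
    have h3 := real_inner_self_nonneg (x := x k - a)
    simp only [inner_sub_left, inner_sub_right, real_inner_smul_right,
      ← real_inner_self_eq_norm_sq] at *
    rw [real_inner_comm (x k) a, real_inner_comm (x k) p] at *
    linarith)
  simp only [inner_sub_left, inner_sub_right, real_inner_smul_right,
      ← real_inner_self_eq_norm_sq] at *
  rw [real_inner_comm a p] at *
  linarith

/-- Opial's lemma: if `x` is Fejér monotone with respect to a nonempty set that contains all weak
cluster points of `x`, then `x` converges weakly to a point of this set. -/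
theorem exists_weakLim_of_fejer [CompleteSpace H] {x : ℕ → H} {S : Set H} (hS : S.Nonempty)
    (hf : ∀ a ∈ S, Antitone fun k => ‖x k - a‖)
    (hcl : ∀ U : Ultrafilter ℕ, (U : Filter ℕ) ≤ atTop → ∀ a, WeakLim (U : Filter ℕ) x a → a ∈ S) :
    ∃ a ∈ S, WeakLim atTop x a := by
  obtain ⟨s, hs⟩ := hS
  have hbd : ∀ k, ‖x k‖ ≤ ‖x 0 - s‖ + ‖s‖ := fun k => by
    have h1 := norm_add_le (x k - s) s
    rw [sub_add_cancel] at h1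
    exact h1.trans (add_le_add (hf s hs (Nat.zero_le k)) le_rfl)
  have hlim : ∀ a ∈ S, ∃ r, Tendsto (fun k => ‖x k - a‖ ^ 2) atTop (𝓝 r) := fun a ha =>
    ⟨_, (tendsto_atTop_ciInf (hf a ha) ⟨0, by
      rintro _ ⟨k, rfl⟩; exact norm_nonneg _⟩).pow 2⟩
  have hex : ∀ U : Ultrafilter ℕ, ∃ a, WeakLim (U : Filter ℕ) x a := fun U =>
    exists_weakLim_of_bounded U (Eventually.of_forall hbd)
  have huniq : ∀ U V : Ultrafilter ℕ, (U : Filter ℕ) ≤ atTop → (V : Filter ℕ) ≤ atTop →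
      ∀ a b, WeakLim (U : Filter ℕ) x a → WeakLim (V : Filter ℕ) x b → a = b := by
    intro U V hU hV a b ha hb
    obtain ⟨r, hr⟩ := hlim a (hcl U hU a ha)
    obtain ⟨t, ht⟩ := hlim b (hcl V hV b hb)
    -- `‖x k - b‖ ^ 2 - ‖x k - a‖ ^ 2` is affine in `x k`, hence `⟪x k, a - b⟫` converges
    have h1 := ((ht.sub hr).sub_const (‖b‖ ^ 2 - ‖a‖ ^ 2)).const_mul (1 / 2)
    have h2 : (fun k => 1 / 2 * (‖x k - b‖ ^ 2 - ‖x k - a‖ ^ 2 - (‖b‖ ^ 2 - ‖a‖ ^ 2))) =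
        fun k => ⟪x k, a - b⟫_ℝ := by
      funext k
      rw [norm_sub_sq_real, norm_sub_sq_real, inner_sub_right]
      ring
    rw [h2] at h1
    have h3 := tendsto_nhds_unique (ha (a - b)) (h1.mono_left hU)
    have h4 := tendsto_nhds_unique (hb (a - b)) (h1.mono_left hV)
    have h5 : ⟪a - b, a - b⟫_ℝ = 0 := by rw [inner_sub_left, h3, h4, sub_self]
    exact sub_eq_zero.1 (inner_self_eq_zero.1 h5)
  obtain ⟨U₀, hU₀⟩ := Ultrafilter.exists_le (atTop : Filter ℕ)
  obtain ⟨a, ha⟩ := hex U₀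
  refine ⟨a, hcl U₀ hU₀ a ha, WeakLim.of_ultrafilter fun U hU => ?_⟩
  obtain ⟨b, hb⟩ := hex U
  rwa [huniq U₀ U hU₀ hU a b ha hb]

/-! ### Resolvents of maximal comonotone operators -/

/-- The finite case of Minty's theorem: a maximizer `t` of the dual function
`∑ i, t i * ⟪y i, b i⟫ - ‖∑ i, (t i / 2) • (y i + b i)‖ ^ 2` on the simplex yields the point
`x = ∑ i, (t i / 2) • (y i + b i)`. -/
theorem exists_forall_inner_sub_sub_nonpos {ι : Type*} [Fintype ι] (y b : ι → H)
    (hyb : ∀ i j, ⟪y i - y j, b i - b j⟫_ℝ ≤ 0) : ∃ x : H, ∀ i, ⟪x - y i, x - b i⟫_ℝ ≤ 0 := by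
  classical
  rcases isEmpty_or_nonempty ι with hι | hι
  · exact ⟨0, fun i => hι.elim i⟩
  let c : (ι → ℝ) → H := fun t => ∑ i, t i • ((1 / 2 : ℝ) • (y i + b i))
  let D : (ι → ℝ) → ℝ := fun t => ∑ i, t i * ⟪y i, b i⟫_ℝ
  have hcont : Continuous fun t => D t - ‖c t‖ ^ 2 := by fun_prop
  obtain ⟨t, ht, hmax⟩ := (isCompact_stdSimplex ℝ ι).exists_isMaxOn
    ⟨_, single_mem_stdSimplex ℝ (Classical.arbitrary ι)⟩ hcont.continuousOn
  refine ⟨c t, fun i => ?_⟩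
  -- the dual function is nonpositive at `t`
  have hneg : D t - ‖c t‖ ^ 2 ≤ 0 := by
    set Y := ∑ i, t i • y i
    set Z := ∑ i, t i • b i
    have hc : c t = (1 / 2 : ℝ) • (Y + Z) := by
      simp only [c, Y, Z, smul_add, Finset.sum_add_distrib, Finset.smul_sum, smul_comm (t _)]
    have hsum : ∑ i, ∑ j, t i * t j * ⟪y i - y j, b i - b j⟫_ℝ = 2 * D t - 2 * ⟪Y, Z⟫_ℝ := by
      have e1 : ⟪Y, Z⟫_ℝ = ∑ i, ∑ j, t i * t j * ⟪y i, b j⟫_ℝ := by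
        refine (sum_inner _ _ _).trans (Finset.sum_congr rfl fun i _ =>
          (inner_sum _ _ _).trans (Finset.sum_congr rfl fun j _ => ?_))
        rw [real_inner_smul_left, real_inner_smul_right, mul_assoc]
      have e2 : ⟪Y, Z⟫_ℝ = ∑ i, ∑ j, t i * t j * ⟪y j, b i⟫_ℝ := by
        rw [e1, Finset.sum_comm]
        exact Finset.sum_congr rfl fun i _ => Finset.sum_congr rfl fun j _ => by
          rw [mul_comm (t j)]
      have e3 : D t = ∑ i, ∑ j, t i * t j * ⟪y i, b i⟫_ℝ := by
        refine Finset.sum_congr rfl fun i _ => ?_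
        rw [← Finset.sum_mul, ← Finset.mul_sum, ht.2, mul_one]
      have e4 : D t = ∑ i, ∑ j, t i * t j * ⟪y j, b j⟫_ℝ := by
        rw [e3, Finset.sum_comm]
        exact Finset.sum_congr rfl fun i _ => Finset.sum_congr rfl fun j _ => by
          rw [mul_comm (t j)]
      have e5 : 2 * D t - 2 * ⟪Y, Z⟫_ℝ = D t + D t - ⟪Y, Z⟫_ℝ - ⟪Y, Z⟫_ℝ := by ring
      rw [e5]
      nth_rewrite 1 [e3]
      rw [e4]
      nth_rewrite 1 [e1]
      rw [e2]
      simp only [← Finset.sum_add_distrib, ← Finset.sum_sub_distrib]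
      refine Finset.sum_congr rfl fun i _ => Finset.sum_congr rfl fun j _ => ?_
      simp only [inner_sub_left, inner_sub_right]
      ring
    have hle : ∑ i, ∑ j, t i * t j * ⟪y i - y j, b i - b j⟫_ℝ ≤ 0 :=
      Finset.sum_nonpos fun i _ => Finset.sum_nonpos fun j _ =>
        mul_nonpos_of_nonneg_of_nonpos (mul_nonneg (ht.1 i) (ht.1 j)) (hyb i j)
    have h1 := real_inner_self_nonneg (x := Y - Z)
    rw [hc, ← real_inner_self_eq_norm_sq]
    simp only [inner_sub_left, inner_sub_right, inner_add_left, inner_add_right,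
      real_inner_smul_left, real_inner_smul_right, real_inner_comm Y Z] at *
    linarith
  set m : H := (1 / 2 : ℝ) • (y i + b i)
  -- optimality of `t` in the direction of the `i`-th vertex
  have hdir : ∀ s : ℝ, 0 < s → s ≤ 1 →
      ⟪y i, b i⟫_ℝ - D t - 2 * ⟪c t, m - c t⟫_ℝ ≤ s * ‖m - c t‖ ^ 2 := by
    intro s hs0 hs1
    have hmem := (convex_stdSimplex ℝ ι) ht (single_mem_stdSimplex ℝ i)
      (sub_nonneg.2 hs1) hs0.le (sub_add_cancel 1 s)
    have h1 : D ((1 - s) • t + s • Pi.single i 1) - ‖c ((1 - s) • t + s • Pi.single i 1)‖ ^ 2 ≤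
      D t - ‖c t‖ ^ 2 := hmax hmem
    have hD : D ((1 - s) • t + s • Pi.single i 1) = (1 - s) * D t + s * ⟪y i, b i⟫_ℝ := by
      simp [D, add_mul, Finset.sum_add_distrib, Finset.mul_sum, Pi.single_apply, mul_assoc]
    have hc : c ((1 - s) • t + s • Pi.single i 1) = c t + s • (m - c t) := by
      have : c ((1 - s) • t + s • Pi.single i 1) = (1 - s) • c t + s • m := by
        simp only [c, Pi.add_apply, Pi.smul_apply, smul_eq_mul, add_smul, mul_smul,
          Finset.sum_add_distrib, ← Finset.smul_sum, Pi.single_apply, ite_smul, one_smul,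
          zero_smul, Finset.sum_ite_eq', Finset.mem_univ, if_true, m]
      rw [this]
      module
    rw [hD, hc, norm_add_sq_real, norm_smul, real_inner_smul_right, Real.norm_eq_abs, mul_pow,
      sq_abs] at h1
    refine le_of_mul_le_mul_left ?_ hs0
    linarith
  have hlim : ⟪y i, b i⟫_ℝ - D t - 2 * ⟪c t, m - c t⟫_ℝ ≤ 0 := by
    have h1 : Tendsto (fun s : ℝ => s * ‖m - c t‖ ^ 2) (𝓝[>] 0) (𝓝 0) := by
      have : Continuous fun s : ℝ => s * ‖m - c t‖ ^ 2 := by fun_prop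
      simpa using (this.tendsto 0).mono_left nhdsWithin_le_nhds
    refine ge_of_tendsto h1 ?_
    filter_upwards [Ioc_mem_nhdsGT (zero_lt_one' ℝ)] with s hs
    exact hdir s hs.1 hs.2
  simp only [m, inner_sub_left, inner_sub_right, inner_add_right, real_inner_smul_right,
    ← real_inner_self_eq_norm_sq, real_inner_comm (c t) (y i)] at *
  linarith

/-- Minty's theorem in the form of an intersection property of balls: it follows from the finite
case by weak compactness. -/
theorem exists_forall_mem_inner_sub_sub_nonpos [CompleteSpace H] (G : Set (H × H))
    (hG : ∀ p ∈ G, ∀ q ∈ G, ⟪p.1 - q.1, p.2 - q.2⟫_ℝ ≤ 0) :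
    ∃ x : H, ∀ p ∈ G, ⟪x - p.1, x - p.2⟫_ℝ ≤ 0 := by
  rcases G.eq_empty_or_nonempty with rfl | ⟨p₀, hp₀⟩
  · exact ⟨0, fun p hp => hp.elim⟩
  have hfin : ∀ F : Finset G, ∃ x : H, ∀ p ∈ F, ⟪x - p.1.1, x - p.1.2⟫_ℝ ≤ 0 := by
    intro F
    obtain ⟨x, hx⟩ := exists_forall_inner_sub_sub_nonpos
      (fun p : F => p.1.1.1) (fun p : F => p.1.1.2) fun p q => hG _ p.1.2 _ q.1.2
    exact ⟨x, fun p hp => hx ⟨p, hp⟩⟩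
  choose x hx using hfin
  have hev : ∀ p : G, ∀ᶠ F in (atTop : Filter (Finset G)), ⟪x F - p.1.1, x F - p.1.2⟫_ℝ ≤ 0 :=
    fun p => by
      filter_upwards [eventually_ge_atTop {p}] with F hF
      exact hx F p (Finset.singleton_subset_iff.1 hF)
  let U := Ultrafilter.of (atTop : Filter (Finset G))
  have hU : (U : Filter (Finset G)) ≤ atTop := Ultrafilter.of_le _
  obtain ⟨a, ha⟩ := exists_weakLim_of_bounded U (x := x)
    (C := 1 + ‖p₀.1 - p₀.2‖ + ‖p₀.1‖) (by
      filter_upwards [hU (hev ⟨p₀, hp₀⟩)] with F hF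
      have h1 : ‖x F - p₀.1‖ ≤ ‖p₀.1 - p₀.2‖ := by
        have e : x F - p₀.2 = (x F - p₀.1) + (p₀.1 - p₀.2) := by abel
        change ⟪x F - p₀.1, x F - p₀.2⟫_ℝ ≤ 0 at hF
        rw [e, inner_add_right, real_inner_self_eq_norm_sq] at hF
        have h2 := abs_le.1 (abs_real_inner_le_norm (x F - p₀.1) (p₀.1 - p₀.2))
        by_contra! hlt
        nlinarith [norm_nonneg (x F - p₀.1), norm_nonneg (p₀.1 - p₀.2)]
      have h2 := norm_add_le (x F - p₀.1) p₀.1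
      rw [sub_add_cancel] at h2
      linarith)
  exact ⟨a, fun p hp => ha.inner_sub_sub_nonpos (hU (hev ⟨p, hp⟩))⟩

theorem mem_resolvent {γ : ℝ} {A : SetOp H} {w p : H} :
    p ∈ resolvent γ A w ↔ ∃ a ∈ A p, p + γ • a = w := by
  simp only [resolvent, inv, idOp, Set.mem_ofPred_eq, Pi.add_apply, Pi.smul_apply, Set.mem_add,
    Set.mem_smul_set, Set.mem_singleton_iff, exists_eq_left, exists_exists_and_eq_and]

/-- Minty's theorem for comonotone operators: `Id + γ A` is surjective if `A` is maximal
`α`-comonotone with `0 < γ + α`. -/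
theorem IsMaximalComonotone.exists_add_smul_eq [CompleteSpace H] {α γ : ℝ} {A : SetOp H}
    (hA : IsMaximalComonotone α A) (hρ : 0 < γ + α) (w : H) :
    ∃ y a, a ∈ A y ∧ y + γ • a = w := by
  have hmax := (isMaximalComonotone_iff α A).1 hA
  -- `y - α a` is a monotone function of `a` on the graph of `A`
  obtain ⟨m, hm⟩ := exists_forall_mem_inner_sub_sub_nonpos
    ((fun p : H × H => (p.1 - α • p.2, w - (γ + α) • p.2)) '' gra A) (by
      rintro _ ⟨⟨y, a⟩, hp, rfl⟩ _ ⟨⟨y', a'⟩, hq, rfl⟩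
      have h1 := hA.1 y a y' a' hp hq
      have e1 : y - α • a - (y' - α • a') = (y - y') - α • (a - a') := by module
      have e2 : w - (γ + α) • a - (w - (γ + α) • a') = -((γ + α) • (a - a')) := by module
      simp only [e1, e2, inner_neg_right, real_inner_smul_right]
      rw [inner_sub_left, real_inner_smul_left, real_inner_self_eq_norm_sq]
      nlinarith)
  set a : H := (γ + α)⁻¹ • (w - m) with ha
  have hw : w = m + (γ + α) • a := by rw [ha, smul_inv_smul₀ hρ.ne']; abel
  refine ⟨m + α • a, a, (hmax _ _).2 fun y' a' hp => ?_, by rw [hw]; module⟩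
  have h1 := hm _ ⟨(y', a'), hp, rfl⟩
  have e1 : m - (y' - α • a') = (m + α • a - y') - α • (a - a') := by module
  have e2 : m - (w - (γ + α) • a') = -((γ + α) • (a - a')) := by rw [hw]; module
  simp only [e1, e2, inner_neg_right, real_inner_smul_right] at h1
  rw [inner_sub_left, real_inner_smul_left, real_inner_self_eq_norm_sq] at h1
  by_contra! hlt
  nlinarith

/-- Applied to differences of graph points, this says that `w ↦ a`, with `w = y + γ a`, is Lipschitz
continuous with constant `(γ + α)⁻¹`. -/
theorem mul_norm_le_norm_add_smul {α γ : ℝ} {y a : H} (h : α * ‖a‖ ^ 2 ≤ ⟪y, a⟫_ℝ) :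
    (γ + α) * ‖a‖ ≤ ‖y + γ • a‖ := by
  have h1 : (γ + α) * ‖a‖ ^ 2 ≤ ‖y + γ • a‖ * ‖a‖ := by
    refine le_trans ?_ (real_inner_le_norm (y + γ • a) a)
    rw [inner_add_left, real_inner_smul_left, real_inner_self_eq_norm_sq]
    linarith
  rcases (norm_nonneg a).eq_or_lt with h0 | h0
  · rw [← h0, mul_zero]; exact norm_nonneg _
  · refine le_of_mul_le_mul_right ?_ h0
    linarith

theorem IsComonotone.eq_of_add_smul_eq {α γ : ℝ} {A : SetOp H} (hA : IsComonotone α A)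
    (hρ : 0 < γ + α) {y a y' a' : H} (ha : a ∈ A y) (ha' : a' ∈ A y')
    (h : y + γ • a = y' + γ • a') : y = y' ∧ a = a' := by
  have h1 := mul_norm_le_norm_add_smul (γ := γ) (hA y a y' a' ha ha')
  have e : y - y' + γ • (a - a') = (y + γ • a) - (y' + γ • a') := by module
  rw [e, h, sub_self, norm_zero] at h1
  have h2 : ‖a - a'‖ = 0 := le_antisymm (nonpos_of_mul_nonpos_right h1 hρ) (norm_nonneg _)
  obtain rfl := sub_eq_zero.1 (norm_eq_zero.1 h2)
  exact ⟨add_right_cancel h, rfl⟩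

theorem IsComonotone.resolvent_eq_singleton {α γ : ℝ} {A : SetOp H} (hA : IsComonotone α A)
    (hρ : 0 < γ + α) {y a : H} (ha : a ∈ A y) : resolvent γ A (y + γ • a) = {y} := by
  ext p
  rw [mem_resolvent, Set.mem_singleton_iff]
  constructor
  · rintro ⟨c, hc, h⟩
    exact (hA.eq_of_add_smul_eq hρ hc ha h).1
  · rintro rfl
    exact ⟨a, ha, rfl⟩

/-- Applied to differences of graph points, this is the Lipschitz continuity of the resolvent. -/
theorem norm_le_mul_norm_add_smul {α γ : ℝ} (hγ : 0 ≤ γ) (hρ : 0 < γ + α) {y a : H}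
    (h : α * ‖a‖ ^ 2 ≤ ⟪y, a⟫_ℝ) : ‖y‖ ≤ (1 + γ / (γ + α)) * ‖y + γ • a‖ := by
  have h1 : ‖a‖ ≤ ‖y + γ • a‖ / (γ + α) := by
    rw [le_div_iff₀ hρ, mul_comm]
    exact mul_norm_le_norm_add_smul h
  have h2 := norm_sub_le (y + γ • a) (γ • a)
  rw [add_sub_cancel_right, norm_smul, Real.norm_of_nonneg hγ] at h2
  calc ‖y‖ ≤ ‖y + γ • a‖ + γ * ‖a‖ := h2
    _ ≤ ‖y + γ • a‖ + γ * (‖y + γ • a‖ / (γ + α)) := by gcongr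
    _ = (1 + γ / (γ + α)) * ‖y + γ • a‖ := by ring

/-! ### Fejér-type descent of the adaptive Douglas-Rachford step -/

/-- Both resolvent parameters dominate the lack of monotonicity. -/
theorem add_pos_of_params {α β γ δ : ℝ} (hαβ : 0 ≤ α + β) (hγ : 0 < γ) (hδ : 0 < δ)
    (hpar_zero : α + β = 0 → δ = γ + 2 * α)
    (hpar_pos : 0 < α + β → (γ + δ) ^ 2 < 4 * (γ + α) * (δ + β)) :
    0 < γ + α ∧ 0 < δ + β := by
  rcases hαβ.eq_or_lt with h | h
  · have h1 := hpar_zero h.symm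
    constructor <;> linarith
  · have h1 := hpar_pos h
    have h2 : 0 < (γ + α) * (δ + β) := by nlinarith [sq_nonneg (γ + δ)]
    rcases pos_and_pos_or_neg_and_neg_of_mul_pos h2 with h3 | h3
    · exact h3
    · linarith [h3.1, h3.2]

/-- The quadratic form that governs one step of the algorithm dominates
`c * ‖a + b‖ ^ 2` for some `c` exceeding `κ * (γ + δ) / 2`. If `0 < α + β`, then it is even
positive definite relative to this bound, which is where the strong convergence comes from. -/
theorem exists_quadratic_lower_bound {α β γ δ κ : ℝ} (hαβ : 0 ≤ α + β) (hγ : 0 < γ) (hδ : 0 < δ)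
    (hpar_zero : α + β = 0 → δ = γ + 2 * α) (hκ : κ < kappaStar α β γ δ) :
    ∃ c ε : ℝ, κ * (γ + δ) / 2 < c ∧ 0 ≤ ε ∧ (0 < α + β → 0 < ε) ∧ ∀ a b : H,
      c * ‖a + b‖ ^ 2 + ε * ‖a‖ ^ 2 ≤
        (γ + α) * ‖a‖ ^ 2 + (δ + β) * ‖b‖ ^ 2 + (γ + δ) * ⟪a, b⟫_ℝ := by
  rcases hαβ.eq_or_lt with h | h
  · rw [kappaStar, if_pos h.symm] at hκ
    refine ⟨(γ + δ) / 2, 0, by nlinarith, le_rfl, fun h' => absurd h h'.ne, fun a b => ?_⟩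
    have h1 := hpar_zero h.symm
    have e1 : γ + α = (γ + δ) / 2 := by linarith
    have e2 : δ + β = (γ + δ) / 2 := by linarith
    rw [e1, e2, norm_add_sq_real]
    linarith
  · rw [kappaStar, if_neg h.ne', lt_div_iff₀ (by positivity)] at hκ
    -- `c` lies strictly between `κ (γ + δ) / 2` and `κ* (γ + δ) / 2`
    obtain ⟨c, hc1, hc2⟩ : ∃ c, κ * (γ + δ) / 2 < c ∧
        c < ((γ + α) * (δ + β) - ((γ + δ) / 2) ^ 2) / (α + β) := exists_between (by
      rw [lt_div_iff₀ h]
      nlinarith)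
    rw [lt_div_iff₀ h] at hc2
    have hQ : 0 < δ + β - c := by
      have h1 : 0 < (δ + β - c) * (α + β) := by nlinarith [sq_nonneg (δ + β - (γ + δ) / 2)]
      exact pos_of_mul_pos_left h1 h.le
    have hε : 0 < (γ + α - c) - ((γ + δ) / 2 - c) ^ 2 / (δ + β - c) := by
      rw [sub_pos, div_lt_iff₀ hQ]
      nlinarith
    refine ⟨c, _, hc1, hε.le, fun _ => hε, fun a b => ?_⟩
    -- completing the square in `b`
    have h2 : 0 ≤ (δ + β - c) * ‖b + (((γ + δ) / 2 - c) / (δ + β - c)) • a‖ ^ 2 := by positivity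
    rw [norm_add_sq_real, norm_smul, real_inner_smul_right, mul_pow, Real.norm_eq_abs, sq_abs] at h2
    have h3 : (δ + β - c) * (‖b‖ ^ 2 + 2 * (((γ + δ) / 2 - c) / (δ + β - c) * ⟪b, a⟫_ℝ) +
        (((γ + δ) / 2 - c) / (δ + β - c)) ^ 2 * ‖a‖ ^ 2) =
        (δ + β - c) * ‖b‖ ^ 2 + 2 * (((γ + δ) / 2 - c) * ⟪b, a⟫_ℝ) +
        ((γ + δ) / 2 - c) ^ 2 / (δ + β - c) * ‖a‖ ^ 2 := by
      field_simp
    rw [h3, real_inner_comm] at h2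
    rw [norm_add_sq_real]
    linarith

theorem quadratic_le_inner {α β γ δ : ℝ} {y a z b : H} (hA : α * ‖a‖ ^ 2 ≤ ⟪y, a⟫_ℝ)
    (hB : β * ‖b‖ ^ 2 ≤ ⟪z, b⟫_ℝ) (h : y - δ • a = z + δ • b) :
    (γ + α) * ‖a‖ ^ 2 + (δ + β) * ‖b‖ ^ 2 + (γ + δ) * ⟪a, b⟫_ℝ ≤ ⟪y + γ • a, a + b⟫_ℝ := by
  have hy : y = z + δ • (a + b) := by
    rw [smul_add, add_comm (δ • a), ← add_assoc, ← h, sub_add_cancel]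
  have h1 : ⟪y, b⟫_ℝ = ⟪z, b⟫_ℝ + δ * (⟪a, b⟫_ℝ + ‖b‖ ^ 2) := by
    rw [hy, inner_add_left, real_inner_smul_left, inner_add_left, real_inner_self_eq_norm_sq]
  simp only [inner_add_left, inner_add_right, real_inner_smul_left, real_inner_self_eq_norm_sq]
  rw [h1]
  linarith

/-- The differences of two instances of an adaptive Douglas-Rachford step satisfy a strengthened
nonexpansiveness inequality. -/
theorem exists_descent {α β γ δ κ : ℝ} (hαβ : 0 ≤ α + β) (hγ : 0 < γ) (hδ : 0 < δ)
    (hpar_zero : α + β = 0 → δ = γ + 2 * α) (hκ_pos : 0 < κ) (hκ : κ < kappaStar α β γ δ) :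
    ∃ η ε : ℝ, 0 < η ∧ 0 ≤ ε ∧ (0 < α + β → 0 < ε) ∧ ∀ y a z b : H,
      α * ‖a‖ ^ 2 ≤ ⟪y, a⟫_ℝ → β * ‖b‖ ^ 2 ≤ ⟪z, b⟫_ℝ → y - δ • a = z + δ • b →
        ‖y + γ • a - (κ * (γ + δ)) • (a + b)‖ ^ 2 + η * ‖a + b‖ ^ 2 + ε * ‖a‖ ^ 2 ≤
          ‖y + γ • a‖ ^ 2 := by
  obtain ⟨c, ε, hc, hε0, hε, hq⟩ := exists_quadratic_lower_bound (H := H) hαβ hγ hδ hpar_zero hκ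
  have hτ : 0 < κ * (γ + δ) := by positivity
  refine ⟨κ * (γ + δ) * (2 * c - κ * (γ + δ)), 2 * (κ * (γ + δ)) * ε,
    mul_pos hτ (by linarith), by positivity, fun h => ?_, fun y a z b hA hB h => ?_⟩
  · have := hε h
    positivity
  · have h1 := mul_le_mul_of_nonneg_left ((hq a b).trans (quadratic_le_inner hA hB h)) hτ.le
    rw [norm_sub_sq_real, norm_smul, real_inner_smul_right, mul_pow, Real.norm_eq_abs, sq_abs]
    linarith

/-! ### Weak limits of the graph inclusions -/

theorem tendsto_inner_zero_of_bounded {ι : Type*} {l : Filter ι} {x s : ι → H} {C : ℝ}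
    (hx : ∀ k, ‖x k‖ ≤ C) (hs : Tendsto s l (𝓝 0)) :
    Tendsto (fun k => ⟪x k, s k⟫_ℝ) l (𝓝 0) := by
  refine squeeze_zero_norm (fun k => (norm_inner_le_norm _ _).trans ?_) (a := fun k => C * ‖s k‖) ?_
  · exact mul_le_mul_of_nonneg_right (hx k) (norm_nonneg _)
  · simpa using hs.norm.const_mul C

/-- Joint demiclosedness of two comonotone operators: the separate graphs are not weakly closed,
but the two comonotonicity inequalities, tested with `(y', a')` and `(z', b')`, may be added and
passed to the limit, since the products `⟪y k, a k⟫` cancel. Testing with the resolvents at the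
weak limits identifies these limits as graph points. -/
theorem mem_of_weakLim [CompleteSpace H] {A B : SetOp H} {α β γ δ : ℝ}
    (hA : IsMaximalComonotone α A) (hB : IsMaximalComonotone β B) (hαβ : 0 ≤ α + β)
    (hρA : 0 < γ + α) (hρB : 0 < δ + β) {ι : Type*} {l : Filter ι} [l.NeBot]
    {y a z b : ι → H} {yl al : H} {C : ℝ} (hya : ∀ k, a k ∈ A (y k)) (hzb : ∀ k, b k ∈ B (z k))
    (hz : ∀ k, y k - δ • a k = z k + δ • b k) (hyC : ∀ k, ‖y k‖ ≤ C) (haC : ∀ k, ‖a k‖ ≤ C)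
    (hs : Tendsto (fun k => a k + b k) l (𝓝 0)) (hy : WeakLim l y yl) (ha : WeakLim l a al) :
    al ∈ A yl ∧ -al ∈ B yl := by
  obtain ⟨y', a', ha', hy'⟩ := hA.exists_add_smul_eq hρA (yl + γ • al)
  obtain ⟨z', b', hb', hz'⟩ := hB.exists_add_smul_eq hρB (yl - δ • al)
  have hlim : 0 ≤ ⟪yl - y', al - a'⟫_ℝ + ⟪yl - z', -al - b'⟫_ℝ - α * ‖al - a'‖ ^ 2 -
      β * ‖-al - b'‖ ^ 2 := by
    -- `η k` and `ξ k` are the weakly vanishing parts of `y k` and `a k`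
    set s : ι → H := fun k => a k + b k
    set η : ι → H := fun k => y k - yl
    set ξ : ι → H := fun k => a k - al
    have hη : ∀ w, Tendsto (fun k => ⟪η k, w⟫_ℝ) l (𝓝 0) := fun w => by
      simpa [η, inner_sub_left] using (hy w).sub_const ⟪yl, w⟫_ℝ
    have hξ : ∀ w, Tendsto (fun k => ⟪ξ k, w⟫_ℝ) l (𝓝 0) := fun w => by
      simpa [ξ, inner_sub_left] using (ha w).sub_const ⟪al, w⟫_ℝ
    have hηs : Tendsto (fun k => ⟪η k, s k⟫_ℝ) l (𝓝 0) :=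
      tendsto_inner_zero_of_bounded (C := C + ‖yl‖)
        (fun k => (norm_sub_le _ _).trans (add_le_add (hyC k) le_rfl)) hs
    have hξs : Tendsto (fun k => ⟪ξ k, s k⟫_ℝ) l (𝓝 0) :=
      tendsto_inner_zero_of_bounded (C := C + ‖al‖)
        (fun k => (norm_sub_le _ _).trans (add_le_add (haC k) le_rfl)) hs
    have hcs : ∀ w : H, Tendsto (fun k => ⟪w, s k⟫_ℝ) l (𝓝 0) := fun w =>
      tendsto_inner_zero_of_bounded (x := fun _ => w) (fun _ => le_rfl) hs
    have hss : Tendsto (fun k => ⟪s k, s k⟫_ℝ) l (𝓝 0) := by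
      simpa using hs.inner (𝕜 := ℝ) hs
    set Y := yl - y'
    set P := al - a'
    set Z := yl - z'
    set Q := -al - b'
    have hsum := ((((((hξ (Y - Z - (2 * α) • P + (2 * β) • Q)).add (hη (P + Q))).add
      (hcs (Z - δ • Q - (2 * β) • Q))).add hηs).add (hξs.const_mul (δ + 2 * β))).sub
      (hss.const_mul (δ + β))).const_add
      (⟪Y, P⟫_ℝ + ⟪Z, Q⟫_ℝ - α * ‖P‖ ^ 2 - β * ‖Q‖ ^ 2)
    simp only [mul_zero, add_zero, sub_zero] at hsum
    refine ge_of_tendsto' hsum fun k => ?_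
    have h1 := hA.1 (y k) (a k) y' a' (hya k) ha'
    have h2 := hB.1 (z k) (b k) z' b' (hzb k) hb'
    have e1 : y k - y' = Y + η k := by simp only [Y, η]; abel
    have e2 : a k - a' = P + ξ k := by simp only [P, ξ]; abel
    have e3 : z k - z' = Z + η k - δ • s k := by
      have : z k = y k - δ • s k := by
        simp only [s]
        rw [eq_sub_of_add_eq (hz k).symm]
        module
      rw [this]
      simp only [Z, η]
      abel
    have e4 : b k - b' = Q - ξ k + s k := by simp only [Q, ξ, s]; abel
    rw [e1, e2] at h1
    rw [e3, e4] at h2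
    -- the only quadratic term in `ξ k` that survives has the favourable sign, so it is dropped
    have h3 : 0 ≤ (α + β) * ‖ξ k‖ ^ 2 := by positivity
    simp only [← real_inner_self_eq_norm_sq, inner_add_left, inner_add_right, inner_sub_left,
      inner_sub_right, real_inner_smul_left, real_inner_smul_right] at h1 h2 h3 ⊢
    simp only [real_inner_comm P (ξ k), real_inner_comm (ξ k) Q, real_inner_comm (s k) Q,
      real_inner_comm (ξ k) Y, real_inner_comm (ξ k) Z, real_inner_comm (ξ k) (η k),
      real_inner_comm (s k) (ξ k)] at h1 h2 h3 ⊢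
    linarith
  have e1 : yl - y' = -(γ • (al - a')) := by
    rw [eq_sub_of_add_eq hy']
    module
  have e2 : yl - z' = -(δ • (-al - b')) := by
    rw [eq_sub_of_add_eq hz']
    module
  rw [e1, e2, inner_neg_left, inner_neg_left, real_inner_smul_left, real_inner_smul_left,
    real_inner_self_eq_norm_sq, real_inner_self_eq_norm_sq] at hlim
  have h1 : 0 ≤ (γ + α) * ‖al - a'‖ ^ 2 := by positivity
  have h2 : 0 ≤ (δ + β) * ‖-al - b'‖ ^ 2 := by positivity
  have h3 : (γ + α) * ‖al - a'‖ ^ 2 = 0 := by linarith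
  have h4 : (δ + β) * ‖-al - b'‖ ^ 2 = 0 := by linarith
  have h5 : al = a' := by simpa [hρA.ne', sub_eq_zero] using h3
  have h6 : -al = b' := by simpa [hρB.ne', sub_eq_zero] using h4
  have h7 : yl = y' := by rw [h5, sub_self, smul_zero, neg_zero] at e1; exact sub_eq_zero.1 e1
  have h8 : yl = z' := by rw [h6, sub_self, smul_zero, neg_zero] at e2; exact sub_eq_zero.1 e2
  constructor
  · rw [h5, h7]; exact ha'
  · rw [h6, h8]; exact hb'

/-! ### Rates -/

/-- The terms of a summable antitone sequence are `o(1 / n)`. -/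
theorem tendsto_mul_zero_of_antitone_of_summable {u : ℕ → ℝ} (hu : Antitone u) (hs : Summable u) :
    Tendsto (fun n : ℕ => (n : ℝ) * u n) atTop (𝓝 0) := by
  have h0 : ∀ n, 0 ≤ u n := fun n => hu.le_of_tendsto hs.tendsto_atTop_zero n
  have hS := hs.hasSum.tendsto_sum_nat
  have hhalf : Tendsto (fun n : ℕ => n / 2) atTop atTop := Nat.tendsto_div_const_atTop two_ne_zero
  have h1 := (hS.sub (hS.comp hhalf)).const_mul 2
  rw [sub_self, mul_zero] at h1
  refine squeeze_zero (fun n => mul_nonneg n.cast_nonneg (h0 n)) (fun n => ?_) h1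
  -- at least `n / 2` terms with index in `[n / 2, n)`, each at least `u n`
  have h2 : (Finset.Ico (n / 2) n).card • u n ≤ ∑ i ∈ Finset.Ico (n / 2) n, u i :=
    Finset.card_nsmul_le_sum _ _ _ fun i hi => hu (Finset.mem_Ico.1 hi).2.le
  rw [Finset.sum_Ico_eq_sub _ (Nat.div_le_self n 2), Nat.card_Ico, nsmul_eq_mul,
    Nat.cast_sub (Nat.div_le_self n 2)] at h2
  have h3 : ((n / 2 : ℕ) : ℝ) ≤ n / 2 := Nat.cast_div_le
  simp only [Function.comp_apply]
  nlinarith [h0 n]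

/-- A nonincreasing square-summable sequence is `o(1 / √k)`. -/
theorem isLittleO_one_div_sqrt {u : ℕ → ℝ} (h0 : ∀ k, 0 ≤ u k) (hu : Antitone u)
    (hs : Summable fun k => u k ^ 2) :
    u =o[atTop] fun k : ℕ => 1 / √(k : ℝ) := by
  have h1 := tendsto_mul_zero_of_antitone_of_summable
    (fun _ _ hij => pow_le_pow_left₀ (h0 _) (hu hij) 2) hs
  rw [isLittleO_iff_tendsto']
  · have h2 := h1.sqrt
    rw [Real.sqrt_zero] at h2
    refine h2.congr fun k => ?_
    rw [Real.sqrt_mul k.cast_nonneg, Real.sqrt_sq (h0 k), div_div_eq_mul_div, div_one, mul_comm]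
  · filter_upwards [eventually_gt_atTop 0] with k hk h
    have : 0 < 1 / √(k : ℝ) := by positivity
    exact absurd h this.ne'

theorem summable_of_add_le {u v : ℕ → ℝ} (hu : ∀ k, 0 ≤ u k) (hv : ∀ k, 0 ≤ v k)
    (h : ∀ k, u (k + 1) + v k ≤ u k) : Summable v := by
  refine summable_of_sum_range_le (c := u 0) hv fun n => ?_
  have key : u n + ∑ i ∈ Finset.range n, v i ≤ u 0 := by
    induction n with
    | zero => simp
    | succ n ih =>
      rw [Finset.sum_range_succ]
      linarith [h n]
  linarith [hu n]

/-! ### Graph form of the algorithm -/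

theorem mem_zer_add {H : Type*} [AddCommGroup H] {A B : SetOp H} {p : H} :
    p ∈ zer (A + B) ↔ ∃ c, c ∈ A p ∧ -c ∈ B p := by
  simp only [zer, Set.mem_ofPred_eq, Pi.add_apply, Set.mem_add]
  constructor
  · rintro ⟨c, hc, d, hd, h⟩
    exact ⟨c, hc, by rwa [neg_eq_of_add_eq_zero_right h]⟩
  · rintro ⟨c, hc, hd⟩
    exact ⟨c, hc, -c, hd, add_neg_cancel c⟩

theorem mu_mul_delta {γ δ lam mu : ℝ} (hlm : (lam - 1) * (mu - 1) = 1)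
    (hδγ : δ = γ * (lam - 1)) : mu * δ = γ + δ := by
  rw [hδγ]
  linear_combination γ * hlm

/-- The adaptive Douglas-Rachford operator in terms of the graph points that the resolvents
select. -/
theorem aDROperator_eq_singleton {A B : SetOp H} {α β γ δ lam mu κ : ℝ} (hA : IsComonotone α A)
    (hB : IsComonotone β B) (hρA : 0 < γ + α) (hρB : 0 < δ + β)
    (hlm : (lam - 1) * (mu - 1) = 1) (hδγ : δ = γ * (lam - 1)) {y a z b : H} (ha : a ∈ A y)
    (hb : b ∈ B z) (h : y - δ • a = z + δ • b) :
    aDROperator κ γ δ lam mu A B (y + γ • a) = {y + γ • a - (κ * (γ + δ)) • (a + b)} := by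
  have h1 : relaxedResolvent lam γ A (y + γ • a) = {z + δ • b} := by
    simp only [relaxedResolvent, Pi.add_apply, Pi.smul_apply, hA.resolvent_eq_singleton hρA ha,
      idOp, Set.smul_set_singleton, Set.singleton_add_singleton]
    congr 1
    rw [← h, hδγ]
    module
  have h2 : relaxedResolvent mu δ B (z + δ • b) = {mu • z + (1 - mu) • (z + δ • b)} := by
    simp only [relaxedResolvent, Pi.add_apply, Pi.smul_apply, hB.resolvent_eq_singleton hρB hb,
      idOp, Set.smul_set_singleton, Set.singleton_add_singleton]
  simp only [aDROperator, comp, Pi.add_apply, Pi.smul_apply, h1, h2, Set.biUnion_singleton,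
    idOp, Set.smul_set_singleton, Set.singleton_add_singleton]
  congr 1
  have hz : z = y - δ • a - δ • b := eq_sub_of_add_eq h.symm
  have hmu := mu_mul_delta hlm hδγ
  rw [hz]
  match_scalars
  · ring
  · ring
  · linear_combination (-κ) * hmu

theorem mem_fixedPts_aDROperator [CompleteSpace H] {A B : SetOp H} {α β γ δ lam mu κ : ℝ}
    (hA : IsMaximalComonotone α A) (hB : IsMaximalComonotone β B) (hρA : 0 < γ + α)
    (hρB : 0 < δ + β) (hγ : 0 < γ) (hδ : 0 < δ) (hκ : 0 < κ)
    (hlm : (lam - 1) * (mu - 1) = 1) (hδγ : δ = γ * (lam - 1)) {x : H} :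
    x ∈ fixedPts (aDROperator κ γ δ lam mu A B) ↔
      ∃ p c, c ∈ A p ∧ -c ∈ B p ∧ p + γ • c = x := by
  have hτ : κ * (γ + δ) ≠ 0 := by positivity
  constructor
  · intro hx
    obtain ⟨y, a, ha, rfl⟩ := hA.exists_add_smul_eq hρA x
    obtain ⟨z, b, hb, hz⟩ := hB.exists_add_smul_eq hρB (y - δ • a)
    rw [fixedPts, Set.mem_ofPred_eq,
      aDROperator_eq_singleton hA.1 hB.1 hρA hρB hlm hδγ ha hb hz.symm, Set.mem_singleton_iff,
      eq_comm, sub_eq_self, smul_eq_zero_iff_right hτ] at hx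
    obtain rfl : b = -a := (neg_eq_of_add_eq_zero_right hx).symm
    obtain rfl : z = y := by
      rw [smul_neg, ← sub_eq_add_neg] at hz
      exact sub_left_injective hz
    exact ⟨z, a, ha, hb, rfl⟩
  · rintro ⟨p, c, hc, hd, rfl⟩
    rw [fixedPts, Set.mem_ofPred_eq, aDROperator_eq_singleton hA.1 hB.1 hρA hρB hlm hδγ hc hd
      (by module), add_neg_cancel, smul_zero, sub_zero]
    rfl

/-- All points of `zer (A + B)` have the same dual certificate if `0 < α + β`. -/
theorem dual_solution_unique {A B : SetOp H} {α β : ℝ} (hA : IsComonotone α A)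
    (hB : IsComonotone β B) (hαβ : 0 < α + β) {p c p' c' : H} (hc : c ∈ A p) (hd : -c ∈ B p)
    (hc' : c' ∈ A p') (hd' : -c' ∈ B p') : c = c' := by
  have h1 := hA p c p' c' hc hc'
  have h2 := hB p (-c) p' (-c') hd hd'
  rw [neg_sub_neg, ← neg_sub c c', norm_neg, inner_neg_right] at h2
  have h3 : (α + β) * ‖c - c'‖ ^ 2 ≤ 0 := by linarith
  have h4 : ‖c - c'‖ ^ 2 = 0 :=
    le_antisymm (nonpos_of_mul_nonpos_right h3 hαβ) (sq_nonneg _)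
  simpa [sub_eq_zero] using h4

/-- Convergence of the algorithm, written in terms of the graph points `(y k, a k)` of `A` and
`(z k, b k)` of `B` that are visited. -/
theorem exists_limit_of_graph_iteration [CompleteSpace H] {A B : SetOp H} {α β γ δ κ : ℝ}
    (hA : IsMaximalComonotone α A) (hB : IsMaximalComonotone β B) (hαβ : 0 ≤ α + β)
    (hzer : (zer (A + B)).Nonempty) (hρA : 0 < γ + α) (hρB : 0 < δ + β) (hγ : 0 < γ) (hδ : 0 < δ)
    (hpar_zero : α + β = 0 → δ = γ + 2 * α) (hκ_pos : 0 < κ) (hκ : κ < kappaStar α β γ δ)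
    {x y z a b : ℕ → H} (hya : ∀ k, a k ∈ A (y k)) (hzb : ∀ k, b k ∈ B (z k))
    (hx : ∀ k, y k + γ • a k = x k) (hz : ∀ k, y k - δ • a k = z k + δ • b k)
    (hstep : ∀ k, x (k + 1) = x k - (κ * (γ + δ)) • (a k + b k)) :
    ∃ p c, c ∈ A p ∧ -c ∈ B p ∧ WeakLim atTop x (p + γ • c) ∧ WeakLim atTop a c ∧
      Tendsto (fun k => a k + b k) atTop (𝓝 0) ∧
      (fun k : ℕ => ‖x k - x (k + 1)‖) =o[atTop] (fun k : ℕ => 1 / √(k : ℝ)) ∧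
      (fun k : ℕ => ‖y k - y (k + 1)‖) =o[atTop] (fun k : ℕ => 1 / √(k : ℝ)) ∧
      (0 < α + β → Tendsto a atTop (𝓝 c)) := by
  obtain ⟨η, ε, hη, hε0, hε, hdesc⟩ :=
    exists_descent (H := H) hαβ hγ hδ hpar_zero hκ_pos hκ
  have hτ : 0 < κ * (γ + δ) := by positivity
  -- descent with respect to an arbitrary solution
  have hsol : ∀ p c, c ∈ A p → -c ∈ B p → ∀ k,
      ‖x (k + 1) - (p + γ • c)‖ ^ 2 + (η * ‖a k + b k‖ ^ 2 + ε * ‖a k - c‖ ^ 2) ≤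
        ‖x k - (p + γ • c)‖ ^ 2 := by
    intro p c hc hd k
    have h1 := hdesc (y k - p) (a k - c) (z k - p) (b k - -c)
      (hA.1 _ _ _ _ (hya k) hc) (hB.1 _ _ _ _ (hzb k) hd) (by
        have e : y k - p - δ • (a k - c) = (y k - δ • a k) - p + δ • c := by module
        rw [e, hz k]
        module)
    have e1 : y k - p + γ • (a k - c) = x k - (p + γ • c) := by rw [← hx k]; module
    have e2 : a k - c + (b k - -c) = a k + b k := by abel
    rw [e1, e2] at h1
    have e3 : x (k + 1) - (p + γ • c) = x k - (p + γ • c) - (κ * (γ + δ)) • (a k + b k) := by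
      rw [hstep k]; abel
    rw [e3]
    linarith
  have hanti : ∀ p c, c ∈ A p → -c ∈ B p → Antitone fun k => ‖x k - (p + γ • c)‖ :=
    fun p c hc hd => antitone_nat_of_succ_le fun k => by
      refine (pow_le_pow_iff_left₀ (norm_nonneg _) (norm_nonneg _) two_ne_zero).1 ?_
      have h1 := hsol p c hc hd k
      have h2 : 0 ≤ η * ‖a k + b k‖ ^ 2 + ε * ‖a k - c‖ ^ 2 := by positivity
      linarith
  have hsummable : ∀ p c, c ∈ A p → -c ∈ B p →
      Summable fun k => η * ‖a k + b k‖ ^ 2 + ε * ‖a k - c‖ ^ 2 := fun p c hc hd =>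
    summable_of_add_le (u := fun k => ‖x k - (p + γ • c)‖ ^ 2) (fun k => sq_nonneg _)
      (fun k => by positivity) (hsol p c hc hd)
  obtain ⟨p₀, hp₀⟩ := hzer
  obtain ⟨c₀, hc₀, hd₀⟩ := mem_zer_add.1 hp₀
  have hsum : Summable fun k => ‖a k + b k‖ ^ 2 := by
    refine (summable_mul_left_iff hη.ne').1 ?_
    refine (hsummable p₀ c₀ hc₀ hd₀).of_nonneg_of_le (fun k => by positivity) fun k => ?_
    have : 0 ≤ ε * ‖a k - c₀‖ ^ 2 := by positivity
    linarith
  have hs0 : Tendsto (fun k => a k + b k) atTop (𝓝 0) := by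
    have h1 := hsum.tendsto_atTop_zero.sqrt
    simp only [Real.sqrt_zero, Real.sqrt_sq (norm_nonneg _)] at h1
    exact tendsto_zero_iff_norm_tendsto_zero.2 h1
  -- the shadow sequences are bounded
  obtain ⟨C, hyC, haC⟩ : ∃ C, (∀ k, ‖y k‖ ≤ C) ∧ ∀ k, ‖a k‖ ≤ C := by
    have hx0 : ∀ k, ‖x k - (p₀ + γ • c₀)‖ ≤ ‖x 0 - (p₀ + γ • c₀)‖ := fun k =>
      hanti p₀ c₀ hc₀ hd₀ (Nat.zero_le k)
    have e : ∀ k, y k - p₀ + γ • (a k - c₀) = x k - (p₀ + γ • c₀) := fun k => by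
      rw [← hx k]; module
    have hy1 : ∀ k, ‖y k‖ ≤ (1 + γ / (γ + α)) * ‖x 0 - (p₀ + γ • c₀)‖ + ‖p₀‖ := fun k => by
      have h1 := norm_le_mul_norm_add_smul hγ.le hρA (hA.1 _ _ _ _ (hya k) hc₀)
      rw [e] at h1
      have h2 := norm_add_le (y k - p₀) p₀
      rw [sub_add_cancel] at h2
      refine h2.trans (add_le_add (h1.trans ?_) le_rfl)
      exact mul_le_mul_of_nonneg_left (hx0 k) (by positivity)
    have ha1 : ∀ k, ‖a k‖ ≤ ‖x 0 - (p₀ + γ • c₀)‖ / (γ + α) + ‖c₀‖ := fun k => by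
      have h1 := mul_norm_le_norm_add_smul (γ := γ) (hA.1 _ _ _ _ (hya k) hc₀)
      rw [e] at h1
      have h2 := norm_add_le (a k - c₀) c₀
      rw [sub_add_cancel] at h2
      refine h2.trans (add_le_add ?_ le_rfl)
      rw [le_div_iff₀ hρA, mul_comm]
      exact h1.trans (hx0 k)
    exact ⟨_, fun k => (hy1 k).trans (le_max_left _ _), fun k => (ha1 k).trans (le_max_right _ _)⟩
  -- cluster points of `x` and `a` are related through a solution
  have hcluster : ∀ U : Ultrafilter ℕ, (U : Filter ℕ) ≤ atTop → ∀ xl al,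
      WeakLim (U : Filter ℕ) x xl → WeakLim (U : Filter ℕ) a al →
      al ∈ A (xl - γ • al) ∧ -al ∈ B (xl - γ • al) := by
    intro U hU xl al hxl hal
    refine mem_of_weakLim hA hB hαβ hρA hρB hya hzb hz hyC haC (hs0.mono_left hU) ?_ hal
    have e : y = fun k => x k - γ • a k := funext fun k => eq_sub_of_add_eq (hx k)
    rw [e]
    exact hxl.sub (hal.smul γ)
  have hexa : ∀ U : Ultrafilter ℕ, ∃ al, WeakLim (U : Filter ℕ) a al := fun U =>
    exists_weakLim_of_bounded U (Eventually.of_forall haC)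
  have hxo : (fun k : ℕ => ‖x k - x (k + 1)‖) =o[atTop] (fun k : ℕ => 1 / √(k : ℝ)) := by
    have e : ∀ k, x k - x (k + 1) = (κ * (γ + δ)) • (a k + b k) := fun k => by
      rw [hstep k, sub_sub_cancel]
    refine isLittleO_one_div_sqrt (fun k => norm_nonneg _) ?_ ?_
    · -- two consecutive iterates form a pair of instances of the step
      refine antitone_nat_of_succ_le fun k =>
        (pow_le_pow_iff_left₀ (norm_nonneg _) (norm_nonneg _) two_ne_zero).1 ?_
      have h1 := hdesc (y k - y (k + 1)) (a k - a (k + 1)) (z k - z (k + 1)) (b k - b (k + 1))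
        (hA.1 _ _ _ _ (hya k) (hya (k + 1))) (hB.1 _ _ _ _ (hzb k) (hzb (k + 1))) (by
          have e : y k - y (k + 1) - δ • (a k - a (k + 1)) =
            (y k - δ • a k) - (y (k + 1) - δ • a (k + 1)) := by module
          rw [e, hz k, hz (k + 1)]
          module)
      have e1 : y k - y (k + 1) + γ • (a k - a (k + 1)) = x k - x (k + 1) := by
        rw [← hx k, ← hx (k + 1)]; module
      have e2 : x (k + 1) - x (k + 1 + 1) = x k - x (k + 1) -
          (κ * (γ + δ)) • (a k - a (k + 1) + (b k - b (k + 1))) := by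
        have e3 : a k - a (k + 1) + (b k - b (k + 1)) =
          (a k + b k) - (a (k + 1) + b (k + 1)) := by abel
        rw [e3, smul_sub, ← e k, ← e (k + 1)]
        abel
      rw [e1, ← e2] at h1
      have h2 : 0 ≤ η * ‖a k - a (k + 1) + (b k - b (k + 1))‖ ^ 2 := by positivity
      have h3 : 0 ≤ ε * ‖a k - a (k + 1)‖ ^ 2 := by positivity
      linarith
    · simp only [e, norm_smul, mul_pow]
      exact hsum.mul_left _
  obtain ⟨_, ⟨p, c, hc, hd, rfl⟩, hxlim⟩ := exists_weakLim_of_fejer (x := x)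
    (S := {w | ∃ p c, c ∈ A p ∧ -c ∈ B p ∧ p + γ • c = w})
    ⟨_, p₀, c₀, hc₀, hd₀, rfl⟩ (by
      rintro _ ⟨p, c, hc, hd, rfl⟩
      exact hanti p c hc hd) (by
      intro U hU w hw
      obtain ⟨al, hal⟩ := hexa U
      obtain ⟨h1, h2⟩ := hcluster U hU w al hw hal
      exact ⟨_, al, h1, h2, sub_add_cancel _ _⟩)
  refine ⟨p, c, hc, hd, hxlim, ?_, hs0, ?_, ?_, ?_⟩
  · refine WeakLim.of_ultrafilter fun U hU => ?_
    obtain ⟨al, hal⟩ := hexa U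
    obtain ⟨h1, -⟩ := hcluster U hU _ al (hxlim.mono hU) hal
    rwa [(hA.1.eq_of_add_smul_eq hρA hc h1 (sub_add_cancel _ _).symm).2]
  · exact hxo
  · refine IsBigO.trans_isLittleO ?_ hxo
    refine IsBigO.of_bound (1 + γ / (γ + α)) (Eventually.of_forall fun k => ?_)
    rw [norm_norm, norm_norm]
    have h1 := norm_le_mul_norm_add_smul hγ.le hρA (hA.1 _ _ _ _ (hya k) (hya (k + 1)))
    have e : y k - y (k + 1) + γ • (a k - a (k + 1)) = x k - x (k + 1) := by
      rw [← hx k, ← hx (k + 1)]; module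
    rwa [e] at h1
  · intro h
    have h1 : Summable fun k => ‖a k - c‖ ^ 2 := by
      refine (summable_mul_left_iff (hε h).ne').1 ?_
      refine (hsummable p c hc hd).of_nonneg_of_le (fun k => by positivity) fun k => ?_
      have : 0 ≤ η * ‖a k + b k‖ ^ 2 := by positivity
      linarith
    have h2 := h1.tendsto_atTop_zero.sqrt
    simp only [Real.sqrt_zero, Real.sqrt_sq (norm_nonneg _)] at h2
    exact tendsto_iff_norm_sub_tendsto_zero.2 h2

end ADR

theorem mainTheorem3 {H : Type*} [NormedAddCommGroup H] [InnerProductSpace ℝ H]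
    [CompleteSpace H] (A B : ADR.SetOp H) (α β γ δ lam mu κ : ℝ)
    (hA : ADR.IsMaximalComonotone α A) (hB : ADR.IsMaximalComonotone β B)
    (hαβ : 0 ≤ α + β) (hzer : (ADR.zer (A + B)).Nonempty)
    (hγ : 0 < γ) (hδ : 0 < δ) (hlam : 1 < lam) (hmu : 1 < mu)
    (hlm : (lam - 1) * (mu - 1) = 1) (hδγ : δ = γ * (lam - 1))
    (hpar_zero : α + β = 0 → δ = γ + 2 * α)
    (hpar_pos : 0 < α + β → (γ + δ) ^ 2 < 4 * (γ + α) * (δ + β))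
    (hκ_pos : 0 < κ) (hκ_lt : κ < ADR.kappaStar α β γ δ) :
    -- the resolvents are single-valued with full domain, so the iterates are well defined
    (∀ w : H, ∃ p : H, ADR.resolvent γ A w = {p}) ∧
    (∀ w : H, ∃ p : H, ADR.resolvent δ B w = {p}) ∧
    ∀ x y z : ℕ → H, ADR.IsADRSequence κ γ δ lam mu A B x y z →
      ∃ xbar p : H,
        -- (i), with `p` the value of the resolvent at `xbar`
        xbar ∈ ADR.fixedPts (ADR.aDROperator κ γ δ lam mu A B) ∧
        ADR.resolvent γ A xbar = {p} ∧
        p ∈ ADR.zer (A + B) ∧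
        ADR.WeaklyTendsto x xbar ∧
        -- (ii)
        (fun k : ℕ => ‖x k - x (k + 1)‖) =o[atTop] (fun k : ℕ => 1 / √(k : ℝ)) ∧
        (fun k : ℕ => ‖y k - y (k + 1)‖) =o[atTop] (fun k : ℕ => 1 / √(k : ℝ)) ∧
        -- (iii)
        ADR.WeaklyTendsto y p ∧
        ADR.WeaklyTendsto z p ∧
        -- (iv)
        (0 < α + β → κ < 1 →
          ((0 < γ + 2 * α ∧ 1 ≤ ADR.kappaStar α β γ δ) ∨
            (γ = δ ∧ lam = 2 ∧ mu = 2 ∧ κ < ADR.kappaStar α β γ δ)) →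
          γ • ADR.yosida γ A xbar = {xbar - p} ∧
          Tendsto (fun k => x k - y k) atTop (𝓝 (xbar - p)) ∧
          Tendsto (fun k => x k - z k) atTop (𝓝 (xbar - p)) ∧
          γ • ADR.yosida γ A xbar + ADR.zer (A + B) =
            ADR.fixedPts (ADR.aDROperator κ γ δ lam mu A B)) := by
  obtain ⟨hρA, hρB⟩ := ADR.add_pos_of_params hαβ hγ hδ hpar_zero hpar_pos
  have hresA : ∀ w : H, ∃ p : H, ADR.resolvent γ A w = {p} := fun w => by
    obtain ⟨y, a, ha, rfl⟩ := hA.exists_add_smul_eq hρA w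
    exact ⟨y, hA.1.resolvent_eq_singleton hρA ha⟩
  have hresB : ∀ w : H, ∃ p : H, ADR.resolvent δ B w = {p} := fun w => by
    obtain ⟨z, b, hb, rfl⟩ := hB.exists_add_smul_eq hρB w
    exact ⟨z, hB.1.resolvent_eq_singleton hρB hb⟩
  refine ⟨hresA, hresB, fun x y z h => ?_⟩
  choose a hya hx using fun k => ADR.mem_resolvent.1 (h.y_mem k)
  choose b hzb hz' using fun k => ADR.mem_resolvent.1 (h.z_mem k)
  have hz : ∀ k, y k - δ • a k = z k + δ • b k := fun k => by
    rw [hz' k, ← hx k, hδγ]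
    module
  have hzy : ∀ k, z k = y k - δ • (a k + b k) := fun k => by
    rw [eq_sub_of_add_eq (hz k).symm]
    module
  have hstep : ∀ k, x (k + 1) = x k - (κ * (γ + δ)) • (a k + b k) := fun k => by
    rw [h.x_succ k, hzy k, ← ADR.mu_mul_delta hlm hδγ]
    module
  obtain ⟨p, c, hc, hd, hxlim, halim, hs, hxo, hyo, hstrong⟩ :=
    ADR.exists_limit_of_graph_iteration hA hB hαβ hzer hρA hρB hγ hδ hpar_zero hκ_pos hκ_lt
      hya hzb hx hz hstep
  have hfix : ∀ w : H, w ∈ ADR.fixedPts (ADR.aDROperator κ γ δ lam mu A B) ↔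
      ∃ p c, c ∈ A p ∧ -c ∈ B p ∧ p + γ • c = w := fun w =>
    ADR.mem_fixedPts_aDROperator hA hB hρA hρB hγ hδ hκ_pos hlm hδγ
  have hres := hA.1.resolvent_eq_singleton hρA hc
  have hylim : ADR.WeakLim atTop y p := by
    have e : y = fun k => x k - γ • a k := funext fun k => eq_sub_of_add_eq (hx k)
    have e' : p = p + γ • c - γ • c := (add_sub_cancel_right _ _).symm
    rw [e, e']
    exact hxlim.sub (halim.smul γ)
  have hzlim : ADR.WeakLim atTop z p := by
    have e : z = fun k => y k - δ • (a k + b k) := funext hzy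
    have h1 := hylim.sub ((ADR.WeakLim.of_tendsto hs).smul δ)
    rw [smul_zero, sub_zero] at h1
    rwa [e]
  refine ⟨p + γ • c, p, (hfix _).2 ⟨p, c, hc, hd, rfl⟩, hres, ADR.mem_zer_add.2 ⟨c, hc, hd⟩,
    hxlim.weaklyTendsto, hxo, hyo, hylim.weaklyTendsto, hzlim.weaklyTendsto, fun hpos _ _ => ?_⟩
  have hyos : γ • ADR.yosida γ A (p + γ • c) = {p + γ • c - p} := by
    simp only [ADR.yosida, Pi.smul_apply, Pi.sub_apply, hres, ADR.idOp,
      Set.singleton_sub_singleton, Set.smul_set_singleton, smul_smul, mul_one_div_cancel hγ.ne',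
      one_smul]
  have hxy : Tendsto (fun k => x k - y k) atTop (𝓝 (p + γ • c - p)) := by
    have e : (fun k => x k - y k) = fun k => γ • a k := funext fun k => by
      rw [← hx k, add_sub_cancel_left]
    rw [e, add_sub_cancel_left]
    exact (hstrong hpos).const_smul γ
  refine ⟨hyos, hxy, ?_, ?_⟩
  · have e : (fun k => x k - z k) = fun k => (x k - y k) + δ • (a k + b k) := funext fun k => by
      rw [hzy k]
      abel
    have h1 := hxy.add (hs.const_smul δ)
    rw [smul_zero, add_zero] at h1
    rwa [e]
  · ext w
    rw [hyos, add_sub_cancel_left, Set.singleton_add, Set.mem_image, hfix]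
    -- by uniqueness of the dual solution, every fixed point is a zero of `A + B` shifted by `γ c`
    constructor
    · rintro ⟨q, hq, rfl⟩
      obtain ⟨c', hc', hd'⟩ := ADR.mem_zer_add.1 hq
      obtain rfl := ADR.dual_solution_unique hA.1 hB.1 hpos hc hd hc' hd'
      exact ⟨q, c, hc', hd', add_comm _ _⟩
    · rintro ⟨q, c', hc', hd', rfl⟩
      obtain rfl := ADR.dual_solution_unique hA.1 hB.1 hpos hc hd hc' hd'
      exact ⟨q, ADR.mem_zer_add.2 ⟨c, hc', hd'⟩, add_comm _ _⟩
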